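/- **Conventions.** Let $(X,|\cdot|)$ be a metric space. $B(x,r)$ denotes the closed ball, $d(x,Y)=\inf_{y\in Y}|x-y|$, and $(x|y)_z=\frac12\left(|x-z|+|y-z|-|x-y|\right)$ is the Gromov product. $X$ is a *length space* if the distance between any two points is the infimum of the lengths of the paths joining them. $X$ is *$\delta$-hyperbolic* if $(x|z)_t\ge\min\{(x|y)_t,(y|z)_t\}-\delta$ for all $x,y,z,t\in X$. For $\alpha\ge 0$, a subset $Y$ of a (pseudo-)metric space is *$\alpha$-quasi-convex* if $d(x,Y)\le (y|y')_x+\alpha$ for every point $x$ of the space and all $y,y'\in Y$. Let a group $G$ act by isometries on $X$ and let $\sigma>0$. A *$\sigma$-rotation family* is a collection $\mathcal R$ of pairs $(H,v)$, where $H$ is a subgroup of $G$ and $v\in X$, such that 1. for every $(H,v)\in\mathcal R$, $H$ fixes $v$, and $|hx-x|=2|v-x|$ for every $x\in B(v,\sigma/10)$ and every $h\in H\setminus\{1\}$; 2. if $(H,v)\ne(H',v')$ are two elements of $\mathcal R$, then $|v-v'|\ge\sigma$; 3. $(gHg^{-1},gv)\in\mathcal R$ for every $g\in G$ and $(H,v)\in\mathcal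 R$. Let $v(\mathcal R)$ be the set of all *apices*, that is of all points $v$ with $(H,v)\in\mathcal R$ for some $H$. Let $K$ be the subgroup of $G$ generated by all $H$ with $(H,v)\in\mathcal R$ for some $v$. Let $\bar X=X/K$, let $\nu:X\to\bar X$, $x\mapsto\bar x$, be the canonical map, and endow $\bar X$ with the pseudo-metric $|\bar x-\bar x'|=\inf_{g\in K}|gx-x'|$. **Proposition.** For every $\delta>0$ there exists $\sigma_0>0$, depending only on $\delta$, with the following property. Let $G$ be a group acting by isometries on a $\delta$-hyperbolic length space $X$, let $\sigma\ge\sigma_0$ and let $\mathcal R$ be a $\sigma$-rotation family. Let $\alpha\ge 0$ and let $\bar Y$ be an $\alpha$-quasi-convex subset of $\bar X$ such that, for every $v\in v(\mathcal R)$, $\bar Y$ does not intersect $B(\bar v,\sigma/10+\alpha+8\delta)$. Let $\bar y_0\in\bar Y$ and let $y_0\in X$ be a preimage of $\bar y_0$. Then there exists a subset $Y$ of $X$ containing $y_0$ such that $\nu$ induces an isometry from $Y$ onto $\bar Y$; that is, $\nu(Y)=\bar Y$ and $|\bar y-\bar y'|=|y-y'|$ for all $y,y'\in Y$. -/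

import Mathlib

open scoped NNReal ENNReal

universe u v

section MetricNotions

/-- A metric space is a length space if the distance between two points is the infimum of the
lengths of the continuous paths joining them. In particular such a space is path connected. -/
def IsLengthSpace (X : Type*) [PseudoMetricSpace X] : Prop :=
  ∀ x y : X, edist x y = ⨅ γ : Path x y, eVariationOn γ Set.univ

/-- The Gromov product `(x | y)_z`. -/
noncomputable def gromovProduct {X : Type*} [PseudoMetricSpace X] (x y z : X) : ℝ :=
  (dist x z + dist y z - dist x y) / 2

/-- The four point condition. -/
def IsGromovHyperbolic (X : Type*) [PseudoMetricSpace X] (δ : ℝ) : Prop :=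
  ∀ x y z t : X,
    min (gromovProduct x y t) (gromovProduct y z t) - δ ≤ gromovProduct x z t

/-- `Y` is `α`-quasi-convex: `d(x, Y) ≤ (y | y')_x + α` for all points `x` of the space and all
`y, y'` in `Y`. -/
def IsQuasiConvex {X : Type*} [PseudoMetricSpace X] (α : ℝ) (Y : Set X) : Prop :=
  ∀ x : X, ∀ y ∈ Y, ∀ y' ∈ Y, Metric.infDist x Y ≤ gromovProduct y y' x + α

end MetricNotions

section OrbitSpaces

/-- The space of orbits of a subgroup `K` of a group acting by isometries on `X`. -/
def OrbitSpace {G : Type*} [Group G] (K : Subgroup G) (X : Type*) [MulAction G X] : Type _ :=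
  MulAction.orbitRel.Quotient K X

/-- The canonical map from `X` to its quotient by `K`. -/
def OrbitSpace.mk {G : Type*} [Group G] (K : Subgroup G) {X : Type*} [MulAction G X] (x : X) :
    OrbitSpace K X :=
  Quotient.mk (MulAction.orbitRel K X) x

/-- The infimum over `g ∈ K` of `dist (g x) x'`. -/
noncomputable def orbitDist {G : Type*} [Group G] (K : Subgroup G) {X : Type*} [MetricSpace X]
    [MulAction G X] (x x' : X) : ℝ :=
  ⨅ g : K, dist ((g : G) • x) x'

variable {G : Type*} [Group G] (K : Subgroup G) {X : Type*} [MetricSpace X] [MulAction G X]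

theorem orbitDist_bddBelow (x x' : X) :
    BddBelow (Set.range fun g : K => dist ((g : G) • x) x') :=
  ⟨0, by rintro _ ⟨g, rfl⟩; exact dist_nonneg⟩

theorem orbitDist_le (x x' : X) (g : K) : orbitDist K x x' ≤ dist ((g : G) • x) x' :=
  ciInf_le (orbitDist_bddBelow K x x') g

theorem orbitDist_smul_left (g : K) (x x' : X) :
    orbitDist K ((g : G) • x) x' = orbitDist K x x' := by
  unfold orbitDist
  refine Equiv.iInf_congr (Equiv.mulRight g) fun h => ?_
  simp [mul_smul]

theorem orbitDist_comm [IsIsometricSMul G X] (x x' : X) :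
    orbitDist K x x' = orbitDist K x' x := by
  unfold orbitDist
  refine Equiv.iInf_congr (Equiv.inv K) fun h => ?_
  have := dist_smul (h : G) (((h : G)⁻¹) • x') x
  simpa [dist_comm] using this.symm

theorem orbitDist_triangle [IsIsometricSMul G X] (x y z : X) :
    orbitDist K x z ≤ orbitDist K x y + orbitDist K y z := by
  refine le_ciInf_add_ciInf fun g h => ?_
  have h1 := orbitDist_le K x z (h * g)
  have h2 := dist_triangle (((h * g : K) : G) • x) ((h : G) • y) z
  have h3 : dist (((h * g : K) : G) • x) ((h : G) • y) = dist ((g : G) • x) y := by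
    simp [mul_smul]
  linarith

theorem orbitDist_congr [IsIsometricSMul G X] (x y x' y' : X)
    (hx : MulAction.orbitRel K X x x') (hy : MulAction.orbitRel K X y y') :
    orbitDist K x y = orbitDist K x' y' := by
  obtain ⟨g, rfl⟩ := hx
  obtain ⟨h, rfl⟩ := hy
  change orbitDist K ((g : G) • x') ((h : G) • y') = _
  rw [orbitDist_smul_left, orbitDist_comm, orbitDist_smul_left, orbitDist_comm]

/-- The quotient of `X` by `K`, with the pseudo-metric given by the infimum of the distances
`dist (g x) x'` for `g ∈ K`. -/
noncomputable instance [IsIsometricSMul G X] : PseudoMetricSpace (OrbitSpace K X) where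
  dist a b := Quotient.lift₂ (orbitDist K) (orbitDist_congr K) a b
  dist_self a := by
    induction a using Quotient.inductionOn with
    | h x =>
      refine le_antisymm ?_ (Real.iInf_nonneg fun _ => dist_nonneg)
      simpa using orbitDist_le K x x 1
  dist_comm a b := by
    induction a, b using Quotient.inductionOn₂ with
    | h x y => exact orbitDist_comm K x y
  dist_triangle a b c := by
    induction a, b, c using Quotient.inductionOn₃ with
    | h x y z => exact orbitDist_triangle K x y z

theorem OrbitSpace.dist_mk [IsIsometricSMul G X] (x x' : X) :
    dist (OrbitSpace.mk K x) (OrbitSpace.mk K x') = ⨅ g : K, dist ((g : G) • x) x' :=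
  rfl

end OrbitSpaces

section RotationFamilies

/-- A `σ`-rotation family: a collection of pairs `(H, v)`, where `H` is a subgroup of `G` (a
rotation group) and `v` a point of `X` (an apex). -/
structure IsRotationFamily {G X : Type*} [Group G] [MetricSpace X] [MulAction G X]
    (σ : ℝ) (R : Set (Subgroup G × X)) : Prop where
  le_stabilizer : ∀ H v, (H, v) ∈ R → H ≤ MulAction.stabilizer G v
  large_angle : ∀ H v, (H, v) ∈ R → ∀ x ∈ Metric.closedBall v (σ / 10), ∀ h ∈ H, h ≠ 1 →
    dist (h • x) x = 2 * dist v x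
  apices_apart : ∀ H v H' v', (H, v) ∈ R → (H', v') ∈ R → (H, v) ≠ (H', v') → σ ≤ dist v v'
  invariant : ∀ (g : G) H v, (H, v) ∈ R → (H.map (MulAut.conj g).toMonoidHom, g • v) ∈ R

/-- The set of apices. -/
def apices {G X : Type*} [Group G] (R : Set (Subgroup G × X)) : Set X :=
  {v | ∃ H, (H, v) ∈ R}

/-- The subgroup `K` generated by all rotation groups. -/
def rotationSubgroup {G X : Type*} [Group G] (R : Set (Subgroup G × X)) : Subgroup G :=
  sSup {H | ∃ v, (H, v) ∈ R}

end RotationFamilies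

/-! ### Gromov products, almost geodesics and hulls -/

section Hyperbolic

variable {X : Type*} [PseudoMetricSpace X] {δ : ℝ}

/-! Take for `Y` all lifts `y` of points of `Ybar` that are almost as close to `y₀` as the quotient
allows, with error `δ`. Let `y`, `y'` be two of them and let `g` in `K` almost realise the quotient
distance between `y` and `g • y'`. If `g = 1`, the two distances agree up to an arbitrarily small
error.

If `g ≠ 1`, Greendlinger's lemma (`exists_apex_of_mem_rotationSubgroup`) gives an apex `v` with `(y'
| g y')_v ≤ 5δ`. But quasi-convexity of `Ybar`, which stays far from the apices, makes the products
at `v` of `(y', y₀)`, `(y₀, y)` and `(y, g y')` larger than `σ / 10 + 7δ`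
(`le_gromovProduct_of_lift`), and hyperbolicity applied twice gives a contradiction.

Greendlinger's lemma is proved with windmills growing from `{x}`. A growth step adds to `L` the
rotations about nearby apices (sails) and replaces `W` by the hull of its orbit under the new group.
An element of that group is a reduced product of rotations, giving a path through sails. The path
turns by almost `π` at each sail and its inner links are long, so it is almost geodesic
(`IsGromovHyperbolic.chain`): its first sail is the required apex, and an apex near the hull is near
a link (`IsWindmill.grow`). The constants are restored at each step, so the windmills exhaust `X`
and their groups exhaust `K`. -/

theorem gromovProduct_comm (x y z : X) : gromovProduct x y z = gromovProduct y x z := by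
  unfold gromovProduct
  rw [dist_comm x y]
  ring

theorem gromovProduct_le_left (x y z : X) : gromovProduct x y z ≤ dist x z := by
  unfold gromovProduct
  linarith [dist_triangle_left y z x]

theorem gromovProduct_self (x z : X) : gromovProduct x x z = dist x z := by
  unfold gromovProduct
  simp

theorem gromovProduct_base_left (x y : X) : gromovProduct x y x = 0 := by
  unfold gromovProduct
  simp [dist_comm]

theorem gromovProduct_base_right (x y : X) : gromovProduct x y y = 0 := by
  unfold gromovProduct
  simp

theorem dist_sub_dist_le_gromovProduct (x y z : X) :
    dist x z - dist x y ≤ gromovProduct x y z := by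
  unfold gromovProduct
  linarith [dist_triangle x y z]

theorem gromovProduct_le_add_dist (x y z t : X) :
    gromovProduct x y z ≤ gromovProduct x y t + dist z t := by
  unfold gromovProduct
  linarith [dist_triangle_right x z t, dist_triangle_right y z t]

theorem gromovProduct_smul {G : Type*} [Group G] [MulAction G X] [IsIsometricSMul G X] (g : G)
    (x y z : X) : gromovProduct (g • x) (g • y) (g • z) = gromovProduct x y z := by
  unfold gromovProduct
  simp only [dist_smul]

/-- If `z` is almost between `p` and `q`, then, seen from `t`, the directions of `p` and `z` are
almost at least as close as those of `p` and `q`. -/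
theorem gromovProduct_sub_le_of_between (p q z t : X) :
    gromovProduct p q t - gromovProduct p q z ≤ gromovProduct p z t := by
  unfold gromovProduct
  linarith [dist_triangle_left q t z, dist_comm z q, dist_comm z t]

theorem IsGromovHyperbolic.four (hX : IsGromovHyperbolic X δ) (a b c d t : X) :
    min (gromovProduct a b t) (min (gromovProduct b c t) (gromovProduct c d t)) - 2 * δ ≤
      gromovProduct a d t := by
  have h1 := hX a b d t
  have h2 := hX b c d t
  rcases min_cases (gromovProduct a b t) (gromovProduct b d t) with h | h <;>
  rcases min_cases (gromovProduct b c t) (gromovProduct c d t) with h' | h' <;>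
  rcases min_cases (gromovProduct a b t)
    (min (gromovProduct b c t) (gromovProduct c d t)) with h'' | h'' <;>
  -- At four equal points the hyperbolicity condition reads `0 ≤ δ`.
  have hδ := hX t t t t <;> simp only [gromovProduct_self, dist_self, min_self] at hδ <;> linarith

/-- In a hyperbolic space, one of two directions is small as soon as the third one is. -/
theorem IsGromovHyperbolic.le_or_le (hX : IsGromovHyperbolic X δ) {a b t : X} {c : ℝ}
    (h : gromovProduct a b t ≤ c) (u : X) :
    gromovProduct a u t ≤ c + δ ∨ gromovProduct u b t ≤ c + δ := by
  have := hX a u b t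
  rcases min_choice (gromovProduct a u t) (gromovProduct u b t) with h' | h' <;>
    rw [h'] at this
  · left; linarith
  · right; linarith

theorem gromovProduct_add_gromovProduct (a b c : X) :
    gromovProduct a b c + gromovProduct a c b = dist b c := by
  unfold gromovProduct
  rw [dist_comm c b]
  ring

/-- Points at prescribed distance on almost geodesic paths. -/
theorem IsLengthSpace.exists_between (hX : IsLengthSpace X) (x y : X) {l ε : ℝ} (h0 : 0 ≤ l)
    (hl : l ≤ dist x y) (hε : 0 < ε) :
    ∃ m, dist x m = l ∧ dist m y ≤ dist x y - l + ε := by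
  have h1 : ⨅ γ : Path x y, eVariationOn γ Set.univ < edist x y + ENNReal.ofReal ε := by
    rw [← hX x y]
    exact ENNReal.lt_add_right (edist_ne_top _ _) (by simpa using hε)
  obtain ⟨γ, hγ⟩ := iInf_lt_iff.1 h1
  have hcont : Continuous fun t => dist x (γ t) := by fun_prop
  obtain ⟨t, ht⟩ : l ∈ Set.range fun t => dist x (γ t) :=
    mem_range_of_exists_le_of_exists_ge hcont ⟨0, by simpa using h0⟩ ⟨1, by simpa using hl⟩
  refine ⟨γ t, ht, ?_⟩
  have h2 : eVariationOn γ Set.univ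
      = eVariationOn γ (Set.Iic t) + eVariationOn γ (Set.Ici t) := by
    rw [← eVariationOn.union γ (x := t) isGreatest_Iic isLeast_Ici, Set.Iic_union_Ici]
  have h3 : edist x (γ t) ≤ eVariationOn γ (Set.Iic t) := by
    simpa using eVariationOn.edist_le γ (s := Set.Iic t) (x := 0) (y := t) unitInterval.nonneg'
      (Set.mem_Iic.2 le_rfl)
  have h4 : edist (γ t) y ≤ eVariationOn γ (Set.Ici t) := by
    simpa using eVariationOn.edist_le γ (s := Set.Ici t) (x := t) (y := 1) (Set.mem_Ici.2 le_rfl)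
      unitInterval.le_one'
  have h5 : edist x (γ t) + edist (γ t) y < edist x y + ENNReal.ofReal ε :=
    ((add_le_add h3 h4).trans_eq h2.symm).trans_lt hγ
  simp only [edist_dist] at h5
  rw [← ENNReal.ofReal_add dist_nonneg dist_nonneg, ← ENNReal.ofReal_add dist_nonneg hε.le] at h5
  have h6 := (ENNReal.ofReal_lt_ofReal_iff_of_nonneg (by positivity)).1 h5
  have ht' : dist x (γ t) = l := ht
  linarith

/-- A point `t` is at distance about `(a | b)_t` from an almost geodesic from `a` to `b`. -/
theorem IsGromovHyperbolic.exists_proj (hX : IsGromovHyperbolic X δ) (hL : IsLengthSpace X)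
    (hδ : 0 < δ) (a b t : X) :
    ∃ m, gromovProduct a b m ≤ δ ∧ dist t m ≤ gromovProduct a b t + 3 * δ := by
  -- In a tripod, the branch point of `a`, `b`, `t` lies at distance `(b | t)_a` from `a`.
  obtain ⟨m, h1, h2⟩ := hL.exists_between a b (l := gromovProduct b t a) (ε := δ)
    (by unfold gromovProduct; linarith [dist_triangle_right b t a])
    (by rw [dist_comm a b]; exact gromovProduct_le_left b t a) hδ
  refine ⟨m, ?_, ?_⟩
  · unfold gromovProduct
    linarith [dist_comm m b]
  · have h3 := hX t b m a
    have h4 : gromovProduct b t a - δ / 2 ≤ gromovProduct b m a := by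
      unfold gromovProduct at *
      linarith [dist_comm m b, dist_comm m a, dist_comm a b]
    have h5 : gromovProduct b t a - δ / 2 - δ ≤ gromovProduct t m a := by
      rw [gromovProduct_comm t b] at h3
      have := le_min (show gromovProduct b t a - δ / 2 ≤ gromovProduct b t a by linarith) h4
      linarith
    unfold gromovProduct at *
    linarith [dist_comm m a, dist_comm t a, dist_comm a b, dist_comm b t]

/-- The hull of a set: the points lying between two points of the set. -/
def hyperbolicHull (δ : ℝ) (S : Set X) : Set X :=
  {z | ∃ p ∈ S, ∃ q ∈ S, gromovProduct p q z ≤ δ}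

/-- The constant does not depend on `S`, which is why windmills can grow indefinitely. If the pairs
`(p, q)`, `(p, p')`, `(p', q')` all had large products at `t`, so would `(z, p)`, `(p, p')`, `(p',
z')`, hence `(z, z')`. So one pair of points of `S` has an almost geodesic passing near `t`. -/
theorem IsGromovHyperbolic.hull_quasiConvex (hX : IsGromovHyperbolic X δ) (hL : IsLengthSpace X)
    (hδ : 0 < δ) (S : Set X) {z z' : X} (hz : z ∈ hyperbolicHull δ S)
    (hz' : z' ∈ hyperbolicHull δ S) (t : X) :
    ∃ w ∈ hyperbolicHull δ S, dist t w ≤ gromovProduct z z' t + 6 * δ := by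
  obtain ⟨p, hp, q, hq, h⟩ := hz
  obtain ⟨p', hp', q', hq', h'⟩ := hz'
  suffices H : ∃ a ∈ S, ∃ b ∈ S, gromovProduct a b t ≤ gromovProduct z z' t + 3 * δ by
    obtain ⟨a, ha, b, hb, hab⟩ := H
    obtain ⟨m, hm, hm'⟩ := hX.exists_proj hL hδ a b t
    exact ⟨m, ⟨a, ha, b, hb, hm⟩, by linarith⟩
  by_contra! H
  have h1 := H p hp q hq
  have h2 := H p hp p' hp'
  have h3 := H p' hp' q' hq'
  have h4 := gromovProduct_sub_le_of_between p q z t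
  have h5 := gromovProduct_sub_le_of_between p' q' z' t
  have h6 := hX.four z p p' z' t
  rw [gromovProduct_comm z p] at h6
  have h7 : gromovProduct z z' t + 2 * δ < min (gromovProduct p z t)
      (min (gromovProduct p p' t) (gromovProduct p' z' t)) :=
    lt_min (by linarith) (lt_min (by linarith) (by linarith))
  linarith

end Hyperbolic

/-! ### Local-to-global straightness of broken geodesics -/

section Chains

variable {X : Type*} [PseudoMetricSpace X] {δ : ℝ} {c : ℕ → X} {n : ℕ}

/-- The error does not accumulate: hyperbolicity leaves two options, and the bad one makes both
products along one link at most `4δ`, although they add up to its length. Only inner links need to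
be long, so the endpoints may be close to the first and last vertices. -/
theorem IsGromovHyperbolic.chain_forward (hX : IsGromovHyperbolic X δ)
    (hc : ∀ i < n, gromovProduct (c i) (c (i + 2)) (c (i + 1)) ≤ 3 * δ)
    (hd : ∀ i, i + 1 < n → 20 * δ < dist (c (i + 1)) (c (i + 2))) (hδ : 0 < δ) :
    ∀ i < n, gromovProduct (c 0) (c (i + 2)) (c (i + 1)) ≤ 4 * δ := by
  intro i
  induction i with
  | zero => intro hi; linarith [hc 0 hi]
  | succ i ih =>
    intro hi
    have h1 := ih (by omega)
    have h2 := hd i hi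
    have h3 := gromovProduct_add_gromovProduct (c 0) (c (i + 1)) (c (i + 2))
    rcases hX.le_or_le (hc (i + 1) hi) (c 0) with h | h
    · rw [gromovProduct_comm] at h
      simp only [add_assoc, Nat.reduceAdd] at *
      linarith
    · linarith

theorem IsGromovHyperbolic.chain_backward (hX : IsGromovHyperbolic X δ)
    (hc : ∀ i < n, gromovProduct (c i) (c (i + 2)) (c (i + 1)) ≤ 3 * δ)
    (hd : ∀ i, i + 1 < n → 20 * δ < dist (c (i + 1)) (c (i + 2))) (hδ : 0 < δ) :
    ∀ i < n, gromovProduct (c i) (c (n + 1)) (c (i + 1)) ≤ 4 * δ := by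
  intro i hi
  -- Reverse the chain.
  have H := hX.chain_forward (c := fun j => c (n + 1 - j)) (n := n)
    (fun j hj => by
      have := hc (n + 1 - (j + 2)) (by omega)
      rw [gromovProduct_comm] at this
      rwa [show n + 1 - (j + 2) + 2 = n + 1 - j by omega,
        show n + 1 - (j + 2) + 1 = n + 1 - (j + 1) by omega] at this)
    (fun j hj => by
      have := hd (n + 1 - (j + 3)) (by omega)
      rw [dist_comm] at this
      rwa [show n + 1 - (j + 3) + 2 = n + 1 - (j + 1) by omega,
        show n + 1 - (j + 3) + 1 = n + 1 - (j + 2) by omega] at this) hδ (n - 1 - i) (by omega)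
  rw [gromovProduct_comm] at H
  simpa only [show n + 1 - (n - 1 - i + 2) = i by omega,
    show n + 1 - (n - 1 - i + 1) = i + 1 by omega, Nat.sub_zero] using H

theorem IsGromovHyperbolic.chain (hX : IsGromovHyperbolic X δ)
    (hc : ∀ i < n, gromovProduct (c i) (c (i + 2)) (c (i + 1)) ≤ 3 * δ)
    (hd : ∀ i, i + 1 < n → 20 * δ < dist (c (i + 1)) (c (i + 2))) (hδ : 0 < δ) :
    ∀ i < n, gromovProduct (c 0) (c (n + 1)) (c (i + 1)) ≤ 5 * δ := by
  intro i hi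
  have h1 := hX.chain_forward hc hd hδ i hi
  by_cases hi' : i + 1 < n
  · have h2 := hX.chain_backward hc hd hδ (i + 1) hi'
    have h3 := hd i hi'
    have h4 := gromovProduct_add_gromovProduct (c (n + 1)) (c (i + 1)) (c (i + 2))
    rcases hX.le_or_le h1 (c (n + 1)) with h | h
    · linarith
    · rw [gromovProduct_comm] at h2
      simp only [add_assoc, Nat.reduceAdd] at *
      linarith
  · obtain rfl : n = i + 1 := by omega
    linarith

/-- A point close to a geodesic joining the ends of a straight chain is close to one of the
links of the chain. -/
theorem IsGromovHyperbolic.chain_exists_link (hX : IsGromovHyperbolic X δ)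
    (hc : ∀ i < n, gromovProduct (c i) (c (i + 2)) (c (i + 1)) ≤ 3 * δ)
    (hd : ∀ i, i + 1 < n → 20 * δ < dist (c (i + 1)) (c (i + 2))) (hδ : 0 < δ) (u : X) :
    ∃ i ≤ n, gromovProduct (c i) (c (i + 1)) u ≤ gromovProduct (c 0) (c (n + 1)) u + 12 * δ := by
  classical
  -- The link starts at the last vertex, among indices at most `n`, that is almost between `c 0` and
  -- `u`; the next vertex is then almost between `u` and the end. Adding the two near-equalities
  -- gives the bound.
  let P : ℕ → Prop := fun i => gromovProduct (c 0) u (c i) ≤ 6 * δ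
  have h0 : P 0 := by
    change gromovProduct (c 0) u (c 0) ≤ _
    rw [gromovProduct_base_left]; positivity
  have hi : P (Nat.findGreatest P n) := Nat.findGreatest_spec (Nat.zero_le n) h0
  have hin : Nat.findGreatest P n ≤ n := Nat.findGreatest_le n
  have hmax : ∀ k, Nat.findGreatest P n < k → k ≤ n → ¬ P k := fun k =>
    Nat.findGreatest_is_greatest
  generalize Nat.findGreatest P n = i at hi hin hmax
  refine ⟨i, hin, ?_⟩
  have h1 : gromovProduct u (c (n + 1)) (c (i + 1)) ≤ 6 * δ := by
    rcases hin.lt_or_eq with h | rfl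
    · rcases hX.le_or_le (hX.chain hc hd hδ i h) u with h' | h'
      · exact absurd (show P (i + 1) by change _ ≤ _; linarith) (hmax _ (by omega) (by omega))
      · linarith
    · rw [gromovProduct_base_right]; positivity
  have h2 : gromovProduct (c 0) u (c i) ≤ 6 * δ := hi
  have h3 := dist_triangle4 (c 0) (c i) (c (i + 1)) (c (n + 1))
  unfold gromovProduct at *
  linarith [dist_comm u (c i), dist_comm u (c (i + 1)), dist_comm u (c (n + 1)),
    dist_comm (c (n + 1)) (c (i + 1))]

end Chains

/-! ### Elementary properties of rotation families -/

section Rotations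

variable {G X : Type*} [Group G] [MetricSpace X] [MulAction G X] {σ δ : ℝ}
  {R : Set (Subgroup G × X)}

theorem IsRotationFamily.smul_apex (hR : IsRotationFamily σ R) {H : Subgroup G} {v : X}
    (hv : (H, v) ∈ R) {h : G} (hh : h ∈ H) : h • v = v :=
  hR.le_stabilizer H v hv hh

theorem IsRotationFamily.group_unique (hR : IsRotationFamily σ R) (hσ : 0 < σ)
    {H H' : Subgroup G} {v : X} (hv : (H, v) ∈ R) (hv' : (H', v) ∈ R) : H = H' := by
  by_contra hne
  have := hR.apices_apart H v H' v hv hv' (by simpa using hne)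
  rw [dist_self] at this
  linarith

theorem IsRotationFamily.dist_apices (hR : IsRotationFamily σ R) {v v' : X} (hv : v ∈ apices R)
    (hv' : v' ∈ apices R) (hne : v ≠ v') : σ ≤ dist v v' := by
  obtain ⟨H, hH⟩ := hv
  obtain ⟨H', hH'⟩ := hv'
  exact hR.apices_apart H v H' v' hH hH' (by simp [hne])

theorem IsRotationFamily.conj_mem (hR : IsRotationFamily σ R) {H : Subgroup G} {v : X}
    (hv : (H, v) ∈ R) {h : G} (hh : h ∈ H) (g : G) :
    ∃ H', (H', g • v) ∈ R ∧ g * h * g⁻¹ ∈ H' :=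
  ⟨_, hR.invariant g H v hv, ⟨h, hh, by simp⟩⟩

theorem IsRotationFamily.smul_mem_apices (hR : IsRotationFamily σ R) (g : G) {v : X}
    (hv : v ∈ apices R) : g • v ∈ apices R := by
  obtain ⟨H, hH⟩ := hv
  exact ⟨_, hR.invariant g H v hH⟩

/-- A rotation sends far away points to an almost opposite direction. -/
theorem IsRotationFamily.gromovProduct_rotation_le [IsIsometricSMul G X]
    (hR : IsRotationFamily σ R) (hX : IsGromovHyperbolic X δ) (hL : IsLengthSpace X) (hδ : 0 < δ)
    (hσ : 100 * δ ≤ σ) {H : Subgroup G} {v : X} (hv : (H, v) ∈ R) {h : G} (hh : h ∈ H)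
    (h1 : h ≠ 1) {q : X} (hq : 10 * δ ≤ dist v q) : gromovProduct q (h • q) v ≤ 2 * δ := by
  -- The large angle condition holds only near `v`, so it is applied to `m`, which has almost the
  -- same direction as `q` from `v`.
  obtain ⟨m, hm, hm'⟩ := hL.exists_between v q (l := 10 * δ) (by positivity) hq hδ
  have hmq : 9 * δ ≤ gromovProduct m q v := by
    unfold gromovProduct
    linarith [dist_comm m v, dist_comm q v]
  have hrot := hR.large_angle H v hv m (by
    rw [Metric.mem_closedBall, dist_comm]; linarith) h hh h1
  have hmm : gromovProduct m (h • m) v = 0 := by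
    have : dist (h • m) v = dist m v := by
      conv_lhs => rw [← hR.smul_apex hv hh]
      exact dist_smul h m v
    unfold gromovProduct
    linarith [dist_comm m v, dist_comm m (h • m)]
  have hhmq : 9 * δ ≤ gromovProduct (h • q) (h • m) v := by
    have := gromovProduct_smul h q m v
    rw [hR.smul_apex hv hh] at this
    rwa [this, gromovProduct_comm]
  have := hX.four m q (h • q) (h • m) v
  by_contra! hcon
  have h2 : 2 * δ < min (gromovProduct m q v)
      (min (gromovProduct q (h • q) v) (gromovProduct (h • q) (h • m) v)) :=
    lt_min (by linarith) (lt_min hcon (by linarith))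
  linarith

end Rotations

/-! ### Windmills, galleries and Greendlinger's lemma -/

section Windmills

variable {G X : Type*} [Group G] [MetricSpace X] [MulAction G X] {σ δ : ℝ}
  {R : Set (Subgroup G × X)} {x : X} {W : Set X} {L : Subgroup G}

/-- A windmill around `x`: a quasi-convex set `W`, invariant under a group `L` generated by
rotations, such that every apex close to `W` has its rotation group in `L`, and such that the
non trivial elements of `L` move `x` in a way which passes by an apex. -/
structure IsWindmill (δ : ℝ) (R : Set (Subgroup G × X)) (x : X) (W : Set X) (L : Subgroup G) :
    Prop where
  base : x ∈ W
  inv : ∀ g ∈ L, ∀ w ∈ W, g • w ∈ W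
  qc : ∀ p ∈ W, ∀ q ∈ W, ∀ t, ∃ w ∈ W, dist t w ≤ gromovProduct p q t + 6 * δ
  near : ∀ H u, (H, u) ∈ R → ∀ w ∈ W, dist u w ≤ 20 * δ → H ≤ L
  green : ∀ g ∈ L, g ≠ 1 → ∃ v ∈ apices R, gromovProduct x (g • x) v ≤ 5 * δ

/-- The apices to be added to a windmill. -/
def sails (δ : ℝ) (R : Set (Subgroup G × X)) (W : Set X) : Set X :=
  {v | v ∈ apices R ∧ (∀ w ∈ W, 20 * δ < dist v w) ∧ ∃ w ∈ W, dist v w ≤ 50 * δ}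

/-- The group of a windmill after adding the rotations around its sails. -/
def grownGroup (δ : ℝ) (R : Set (Subgroup G × X)) (W : Set X) (L : Subgroup G) : Subgroup G :=
  Subgroup.closure (L ∪ {h | ∃ H v, (H, v) ∈ R ∧ v ∈ sails δ R W ∧ h ∈ H})

omit [MulAction G X] in
theorem le_grownGroup : L ≤ grownGroup δ R W L := fun _ hg =>
  Subgroup.subset_closure (Or.inl hg)

omit [MulAction G X] in
theorem rotation_le_grownGroup {H : Subgroup G} {v : X} (hH : (H, v) ∈ R)
    (hv : v ∈ sails δ R W) : H ≤ grownGroup δ R W L := fun _ hg =>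
  Subgroup.subset_closure (Or.inr ⟨H, v, hH, hv, hg⟩)

/-- A windmill after one step of growth. -/
def grownSet (δ : ℝ) (R : Set (Subgroup G × X)) (W : Set X) (L : Subgroup G) : Set X :=
  hyperbolicHull δ {z | ∃ g ∈ grownGroup δ R W L, ∃ w ∈ W, z = g • w}

/-- Sequences of copies `f i • W` such that two consecutive ones share a sail. -/
structure IsGallery (R : Set (Subgroup G × X)) (C : Set X) (f : ℕ → G) (w : ℕ → X) (n : ℕ) :
    Prop where
  start : f 0 = 1
  adj : ∀ i < n, (f i)⁻¹ • w (i + 1) ∈ C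
  rot : ∀ i < n, ∃ H k, (H, w (i + 1)) ∈ R ∧ k ∈ H ∧ k ≠ 1 ∧ f (i + 1) = k * f i
  ne : ∀ i, i + 1 < n → w (i + 1) ≠ w (i + 2)

omit [MetricSpace X] in
theorem IsGallery.congr {C : Set X} {f f' : ℕ → G} {w w' : ℕ → X} {n : ℕ}
    (h : IsGallery R C f w n) (hf : ∀ i ≤ n, f' i = f i) (hw : ∀ i < n, w' (i + 1) = w (i + 1)) :
    IsGallery R C f' w' n where
  start := by rw [hf 0 (Nat.zero_le n), h.start]
  adj i hi := by rw [hf i hi.le, hw i hi]; exact h.adj i hi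
  rot i hi := by rw [hf i hi.le, hf (i + 1) hi, hw i hi]; exact h.rot i hi
  ne i hi := by rw [hw i (by omega), hw (i + 1) hi]; exact h.ne i hi

omit [MetricSpace X] in
theorem IsGallery.init {C : Set X} {f : ℕ → G} {w : ℕ → X} {n : ℕ}
    (h : IsGallery R C f w (n + 1)) : IsGallery R C f w n where
  start := h.start
  adj i hi := h.adj i (by omega)
  rot i hi := h.rot i (by omega)
  ne i hi := h.ne i (by omega)

omit [MetricSpace X] in
theorem IsGallery.append {C : Set X} {f : ℕ → G} {w : ℕ → X} {n : ℕ}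
    (h : IsGallery R C f w n) {H : Subgroup G} {v : X} {k : G} (hv : (H, v) ∈ R) (hk : k ∈ H)
    (k1 : k ≠ 1) (hC : (f n)⁻¹ • v ∈ C) (hne : n ≠ 0 → w n ≠ v) :
    IsGallery R C (Function.update f (n + 1) (k * f n)) (Function.update w (n + 1) v) (n + 1) := by
  have h' : IsGallery R C (Function.update f (n + 1) (k * f n)) (Function.update w (n + 1) v) n :=
    h.congr (fun i hi => Function.update_of_ne (by omega) _ _)
      (fun i hi => Function.update_of_ne (by omega) _ _)
  refine ⟨h'.start, fun i hi => ?_, fun i hi => ?_, fun i hi => ?_⟩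
  · rcases (Nat.lt_succ_iff.1 hi).lt_or_eq with hi' | rfl
    · exact h'.adj i hi'
    · simpa using hC
  · rcases (Nat.lt_succ_iff.1 hi).lt_or_eq with hi' | rfl
    · exact h'.rot i hi'
    · exact ⟨H, k, by simpa using hv, hk, k1, by simp⟩
  · rcases (show i + 1 ≤ n by omega).lt_or_eq with hi' | rfl
    · exact h'.ne i hi'
    · simpa using hne (by omega)

/-- This is reduction of words: a rotation about a new apex is appended, while one about the last
apex is merged with the last rotation, or cancels it. Merging is possible because an apex determines
its rotation group. -/
theorem IsGallery.step (hR : IsRotationFamily σ R) (hσ : 0 < σ) {C : Set X} {f : ℕ → G}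
    {w : ℕ → X} {n : ℕ} (h : IsGallery R C f w n) {H : Subgroup G} {v : X} {k : G}
    (hv : (H, v) ∈ R) (hk : k ∈ H) (hC : (f n)⁻¹ • v ∈ C) :
    ∃ f' w' n', IsGallery R C f' w' n' ∧ f' n' = k * f n := by
  rcases eq_or_ne k 1 with rfl | k1
  · exact ⟨f, w, n, h, by simp⟩
  by_cases hne : n ≠ 0 → w n ≠ v
  · exact ⟨_, _, _, h.append hv hk k1 hC hne, by simp⟩
  push Not at hne
  obtain ⟨hn, rfl⟩ := hne
  obtain ⟨m, rfl⟩ := Nat.exists_eq_succ_of_ne_zero hn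
  simp only [Nat.succ_eq_add_one] at *
  obtain ⟨H', k', hH', hk', -, hf⟩ := h.rot m (by omega)
  obtain rfl := hR.group_unique hσ hv hH'
  rw [hf, ← mul_assoc]
  by_cases hkk : k * k' = 1
  · exact ⟨f, w, m, h.init, by rw [hkk, one_mul]⟩
  · refine ⟨_, _, _, h.init.append hv (mul_mem hk hk') hkk (h.adj m (by omega)) fun hm => ?_,
      by simp⟩
    obtain ⟨l, rfl⟩ := Nat.exists_eq_succ_of_ne_zero hm
    exact h.ne l (by omega)

theorem IsWindmill.smul_mem_sails [IsIsometricSMul G X] (hR : IsRotationFamily σ R)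
    (hW : IsWindmill δ R x W L) {g : G} (hg : g ∈ L) {v : X} (hv : v ∈ sails δ R W) :
    g • v ∈ sails δ R W := by
  obtain ⟨h1, h2, w, hw, h3⟩ := hv
  refine ⟨hR.smul_mem_apices g h1, fun w' hw' => ?_, g • w, hW.inv g hg w hw, by rwa [dist_smul]⟩
  have := h2 _ (hW.inv g⁻¹ (inv_mem hg) w' hw')
  rwa [← dist_smul g, smul_inv_smul] at this

theorem IsWindmill.exists_gallery [IsIsometricSMul G X] (hR : IsRotationFamily σ R) (hσ : 0 < σ)
    (hW : IsWindmill δ R x W L) {g : G} (hg : g ∈ grownGroup δ R W L) :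
    ∃ f w n, IsGallery R (sails δ R W) f w n ∧ ∃ l ∈ L, g = f n * l := by
  have key : ∀ g s : G, s ∈ (L ∪ {h | ∃ H v, (H, v) ∈ R ∧ v ∈ sails δ R W ∧ h ∈ H} : Set G) →
      (∃ f w n, IsGallery R (sails δ R W) f w n ∧ ∃ l ∈ L, g = f n * l) →
      ∃ f w n, IsGallery R (sails δ R W) f w n ∧ ∃ l ∈ L, g * s = f n * l := by
    rintro g s hs ⟨f, w, n, h, l, hl, rfl⟩
    rcases hs with hs | ⟨H, v, hH, hv, hs⟩
    · exact ⟨f, w, n, h, l * s, mul_mem hl hs, by group⟩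
    -- Right multiplication by `s` is left multiplication by a conjugate of `s`, a rotation about
    -- `(f n * l) • v`; this is a sail of `f n • W` since `L` preserves the sails.
    · obtain ⟨H', hH', hk⟩ := hR.conj_mem hH hs (f n * l)
      obtain ⟨f', w', n', h', hf'⟩ := h.step hR hσ hH' hk (by
        rw [mul_smul, inv_smul_smul]; exact hW.smul_mem_sails hR hl hv)
      exact ⟨f', w', n', h', l, hl, by rw [hf']; group⟩
  induction hg using Subgroup.closure_induction_right with
  | one => exact ⟨fun _ => 1, fun _ => x, 0, ⟨rfl, by simp, by simp, by simp⟩, 1, one_mem _, by simp⟩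
  | mul_right g hg s hs ih => exact key g s hs ih
  | mul_inv_cancel g hg s hs ih =>
    refine key g s⁻¹ ?_ ih
    rcases hs with hs | ⟨H, v, hH, hv, hs⟩
    · exact Or.inl (inv_mem hs)
    · exact Or.inr ⟨H, v, hH, hv, inv_mem hs⟩

theorem IsGallery.mem_grownGroup (hR : IsRotationFamily σ R) {f : ℕ → G} {w : ℕ → X} {n : ℕ}
    (h : IsGallery R (sails δ R W) f w n) : ∀ i ≤ n, f i ∈ grownGroup δ R W L := by
  intro i
  induction i with
  | zero => intro _; rw [h.start]; exact one_mem _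
  | succ i ih =>
    intro hi
    have h1 := ih (by omega)
    obtain ⟨H, k, hH, hk, -, hf⟩ := h.rot i hi
    obtain ⟨H', hH', hk'⟩ := hR.conj_mem hH hk (f i)⁻¹
    have := mul_mem h1 (rotation_le_grownGroup (L := L) hH' (h.adj i hi) hk')
    rw [hf]
    convert this using 1
    group

/-- An apex between two points of a windmill or of its sails is close to the windmill. -/
theorem IsWindmill.exists_dist_le (hR : IsRotationFamily σ R)
    (hX : IsGromovHyperbolic X δ) (hδ : 0 < δ) (hσ : 200 * δ ≤ σ)
    (hW : IsWindmill δ R x W L) {u P Q : X} {b : ℝ} (hu : u ∈ apices R)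
    (hP : P ∈ W ∪ sails δ R W) (hQ : Q ∈ W ∪ sails δ R W) (huP : u ≠ P) (huQ : u ≠ Q)
    (hb : b ≤ 80 * δ) (hPQ : gromovProduct P Q u ≤ b) : ∃ w ∈ W, dist u w ≤ b + 8 * δ := by
  have key : ∀ P ∈ W ∪ sails δ R W, u ≠ P → ∃ P' ∈ W, ∀ Z b, b ≤ 90 * δ →
      gromovProduct P Z u ≤ b → gromovProduct P' Z u ≤ b + δ := by
    rintro P (hP | ⟨hP, -, P', hP', hd⟩) hne
    · exact ⟨P, hP, fun Z b _ h => by linarith⟩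
    · refine ⟨P', hP', fun Z b hb h => ?_⟩
      rcases hX.le_or_le h P' with h' | h'
      · have h1 := dist_sub_dist_le_gromovProduct P P' u
        have h2 := hR.dist_apices hu hP hne
        rw [dist_comm] at h2
        linarith
      · exact h'
  obtain ⟨P', hP', h1⟩ := key P hP huP
  obtain ⟨Q', hQ', h2⟩ := key Q hQ huQ
  have h3 := h1 Q b (by linarith) hPQ
  rw [gromovProduct_comm] at h3
  have h4 := h2 P' (b + δ) (by linarith) h3
  obtain ⟨w, hw, h5⟩ := hW.qc Q' hQ' P' hP' u
  exact ⟨w, hw, by linarith⟩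

omit [MulAction G X] in
theorem sails.ne_of_mem (hδ : 0 < δ) {v w : X} (hv : v ∈ sails δ R W) (hw : w ∈ W) : v ≠ w := by
  rintro rfl
  have := hv.2.1 v hw
  rw [dist_self] at this
  linarith

/-- The paths attached to galleries are almost straight at each sail. -/
theorem IsWindmill.turn_le [IsIsometricSMul G X] (hR : IsRotationFamily σ R)
    (hX : IsGromovHyperbolic X δ) (hL : IsLengthSpace X) (hδ : 0 < δ) (hσ : 200 * δ ≤ σ)
    (hW : IsWindmill δ R x W L) {v P Q : X} (hv : v ∈ sails δ R W)
    (hP : P ∈ W ∪ sails δ R W) (hQ : Q ∈ W ∪ sails δ R W) (hvP : v ≠ P) (hvQ : v ≠ Q)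
    {H : Subgroup G} (hH : (H, v) ∈ R) {k : G} (hk : k ∈ H) (k1 : k ≠ 1) :
    gromovProduct P (k • Q) v ≤ 3 * δ := by
  have h1 : 10 * δ ≤ dist v Q := by
    rcases hQ with hQ | hQ
    · linarith [hv.2.1 Q hQ]
    · linarith [hR.dist_apices hv.1 hQ.1 hvQ]
  have h2 := hR.gromovProduct_rotation_le hX hL hδ (by linarith) hH hk k1 h1
  rcases hX.le_or_le h2 P with h | h
  -- Otherwise `v` would be within `11δ` of `W`, but a sail is more than `20δ` away.
  · rw [gromovProduct_comm] at h
    obtain ⟨w, hw, h3⟩ := hW.exists_dist_le hR hX hδ hσ hv.1 hP hQ hvP hvQ (by linarith) h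
    linarith [hv.2.1 w hw]
  · linarith

variable [IsIsometricSMul G X]

/-- The two families of facts on the path attached to a gallery which make it a straight chain. -/
theorem IsWindmill.gallery_chain (hR : IsRotationFamily σ R)
    (hX : IsGromovHyperbolic X δ) (hL : IsLengthSpace X) (hδ : 0 < δ) (hσ : 200 * δ ≤ σ)
    (hW : IsWindmill δ R x W L) {f : ℕ → G} {w : ℕ → X} {n : ℕ}
    (h : IsGallery R (sails δ R W) f w n) (h0 : w 0 ∈ W) (hn : (f n)⁻¹ • w (n + 1) ∈ W) :
    (∀ i ≤ n, (f i)⁻¹ • w i ∈ W ∪ sails δ R W ∧ (f i)⁻¹ • w (i + 1) ∈ W ∪ sails δ R W) ∧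
    (∀ i < n, gromovProduct (w i) (w (i + 2)) (w (i + 1)) ≤ 3 * δ) ∧
    (∀ i, i + 1 < n → 20 * δ < dist (w (i + 1)) (w (i + 2))) := by
  have hadj : ∀ i < n, (f (i + 1))⁻¹ • w (i + 1) ∈ sails δ R W := by
    intro i hi
    obtain ⟨H, k, hH, hk, -, hf⟩ := h.rot i hi
    rw [hf, mul_inv_rev, mul_smul, hR.smul_apex hH (inv_mem hk)]
    exact h.adj i hi
  have hV : ∀ i ≤ n,
      (f i)⁻¹ • w i ∈ W ∪ sails δ R W ∧ (f i)⁻¹ • w (i + 1) ∈ W ∪ sails δ R W := by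
    intro i hi
    constructor
    · rcases i with _ | i
      · left; simpa [h.start] using h0
      · right; exact hadj i hi
    · rcases hi.lt_or_eq with hi | rfl
      · right; exact h.adj i hi
      · left; exact hn
  have hne : ∀ i ≤ n, n ≠ 0 → w i ≠ w (i + 1) := by
    intro i hi hn0 heq
    rcases i with _ | i
    · have := h.adj 0 (by omega)
      rw [h.start, ← heq, inv_one, one_smul] at this
      exact sails.ne_of_mem hδ this h0 rfl
    · rcases hi.lt_or_eq with hi | rfl
      · exact h.ne i hi heq
      · have := hadj i (by omega)
        rw [heq] at this
        exact sails.ne_of_mem hδ this hn rfl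
  refine ⟨hV, fun i hi => ?_, fun i hi => ?_⟩
  · obtain ⟨H, k, hH, hk, k1, hf⟩ := h.rot i hi
    obtain ⟨H', hH', hk'⟩ := hR.conj_mem hH hk (f i)⁻¹
    have h1 := hne i hi.le (by omega)
    have h2 := hne (i + 1) hi (by omega)
    have hrot : (f i)⁻¹ • w (i + 2)
        = ((f i)⁻¹ * k * (f i)⁻¹⁻¹) • ((f (i + 1))⁻¹ • w (i + 2)) := by
      rw [hf, ← mul_smul]; congr 1; group
    -- Translating by `(f i)⁻¹` puts the turn at a sail of `W` itself, with the rotation conjugated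
    -- accordingly.
    rw [← gromovProduct_smul (f i)⁻¹, hrot]
    refine hW.turn_le hR hX hL hδ hσ (h.adj i hi) (hV i hi.le).1 (hV (i + 1) hi).2 ?_ ?_ hH' hk' ?_
    · rw [Ne, smul_left_cancel_iff]; exact h1.symm
    · intro heq
      have := hR.smul_apex hH' hk'
      rw [heq, ← hrot, ← heq, smul_left_cancel_iff] at this
      exact h2 this.symm
    · intro h3
      exact k1 (by simpa using conj_eq_one_iff.1 h3)
  · obtain ⟨H, k, hH, -⟩ := h.rot i (by omega)
    obtain ⟨H', k', hH', -⟩ := h.rot (i + 1) hi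
    have := hR.dist_apices ⟨H, hH⟩ ⟨H', hH'⟩ (h.ne i hi)
    simp only [add_assoc, Nat.reduceAdd] at *
    linarith

omit [IsIsometricSMul G X] in
/-- An apex near a link of a gallery has its rotation group in the grown group. -/
theorem IsWindmill.rotation_le_of_link (hR : IsRotationFamily σ R)
    (hX : IsGromovHyperbolic X δ) (hδ : 0 < δ) (hσ : 200 * δ ≤ σ)
    (hW : IsWindmill δ R x W L) {u P Q : X} {H : Subgroup G} (hu : (H, u) ∈ R)
    (hP : P ∈ W ∪ sails δ R W) (hQ : Q ∈ W ∪ sails δ R W)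
    (hPQ : gromovProduct P Q u ≤ 33 * δ) : H ≤ grownGroup δ R W L := by
  have hmem : u ∈ W ∪ sails δ R W → H ≤ grownGroup δ R W L := by
    rintro (h | h)
    · exact (hW.near H u hu u h (by rw [dist_self]; positivity)).trans le_grownGroup
    · exact rotation_le_grownGroup hu h
  rcases eq_or_ne u P with rfl | huP
  · exact hmem hP
  rcases eq_or_ne u Q with rfl | huQ
  · exact hmem hQ
  -- The distance is at most `41δ`, so `u` is either within `20δ` of `W` or a sail.
  obtain ⟨w, hw, h1⟩ := hW.exists_dist_le hR hX hδ hσ ⟨H, hu⟩ hP hQ huP huQ (by linarith) hPQ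
  by_cases h2 : ∃ w ∈ W, dist u w ≤ 20 * δ
  · obtain ⟨w', hw', h3⟩ := h2
    exact (hW.near H u hu w' hw' h3).trans le_grownGroup
  · push Not at h2
    exact hmem (Or.inr ⟨⟨H, hu⟩, h2, w, hw, by linarith⟩)

omit [IsIsometricSMul G X] in
theorem le_of_map_conj_le {H K : Subgroup G} {g : G} (hg : g ∈ K)
    (h : H.map (MulAut.conj g⁻¹).toMonoidHom ≤ K) : H ≤ K := by
  intro k hk
  have h1 : g⁻¹ * k * g ∈ K := h ⟨k, hk, by simp⟩
  have h2 := mul_mem (mul_mem hg h1) (inv_mem hg)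
  convert h2 using 1
  group

/-- A gallery leaves `w 0` and `w (n + 1)` unconstrained, so these two slots can receive the
endpoints of the path. -/
theorem IsWindmill.exists_path (hR : IsRotationFamily σ R) (hσ : 0 < σ)
    (hW : IsWindmill δ R x W L) {g : G} (hg : g ∈ grownGroup δ R W L) {p q : X} (hp : p ∈ W)
    (hq : q ∈ W) :
    ∃ f w n, IsGallery R (sails δ R W) f w n ∧ (∃ l ∈ L, g = f n * l) ∧ w 0 = p ∧
      w (n + 1) = g • q ∧ w 0 ∈ W ∧ (f n)⁻¹ • w (n + 1) ∈ W := by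
  obtain ⟨f, w, n, h, l, hl, rfl⟩ := hW.exists_gallery hR hσ hg
  refine ⟨f, Function.update (Function.update w 0 p) (n + 1) ((f n * l) • q), n,
    h.congr (fun _ _ => rfl) fun i hi => ?_, ⟨l, hl, rfl⟩, by simp, by simp, by simpa using hp, ?_⟩
  · rw [Function.update_of_ne (by omega), Function.update_of_ne (by omega)]
  · simpa [mul_smul] using hW.inv l hl q hq

/-- Both `near` and `green` come from the straight path of a gallery. An apex within `20δ` of the
hull has product at most `21δ` for the ends of such a path, hence at most `33δ` for one of its
links. -/
theorem IsWindmill.grow (hR : IsRotationFamily σ R)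
    (hX : IsGromovHyperbolic X δ) (hL : IsLengthSpace X) (hδ : 0 < δ) (hσ : 200 * δ ≤ σ)
    (hW : IsWindmill δ R x W L) :
    IsWindmill δ R x (grownSet δ R W L) (grownGroup δ R W L) where
  base := ⟨x, ⟨1, one_mem _, x, hW.base, by simp⟩, x, ⟨1, one_mem _, x, hW.base, by simp⟩, by
    rw [gromovProduct_self, dist_self]; exact hδ.le⟩
  inv := by
    rintro g hg z ⟨p, ⟨a, ha, p, hp, rfl⟩, q, ⟨b, hb, q, hq, rfl⟩, h⟩
    exact ⟨_, ⟨g * a, mul_mem hg ha, p, hp, (mul_smul _ _ _).symm⟩, _,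
      ⟨g * b, mul_mem hg hb, q, hq, (mul_smul _ _ _).symm⟩, by rwa [gromovProduct_smul]⟩
  qc p hp q hq t := hX.hull_quasiConvex hL hδ _ hp hq t
  near := by
    rintro H u hu z ⟨p, ⟨a, ha, p, hp, rfl⟩, q, ⟨b, hb, q, hq, rfl⟩, h⟩ hd
    have hu' := hR.invariant a⁻¹ H u hu
    refine le_of_map_conj_le ha ?_
    have h1 : gromovProduct p ((a⁻¹ * b) • q) (a⁻¹ • u) ≤ 21 * δ := by
      have := gromovProduct_smul a⁻¹ (a • p) (b • q) u
      rw [inv_smul_smul, ← mul_smul] at this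
      rw [this]
      linarith [gromovProduct_le_add_dist (a • p) (b • q) u z]
    obtain ⟨f, w, n, hg, -, hw0, hwn, h0, hn⟩ :=
      hW.exists_path hR (by linarith) (mul_mem (inv_mem ha) hb) hp hq
    obtain ⟨hV, hc, hl⟩ := hW.gallery_chain hR hX hL hδ hσ hg h0 hn
    obtain ⟨i, hi, h2⟩ := hX.chain_exists_link hc hl hδ (a⁻¹ • u)
    rw [hw0, hwn] at h2
    refine le_of_map_conj_le (hg.mem_grownGroup hR i hi)
      (hW.rotation_le_of_link hR hX hδ hσ (hR.invariant (f i)⁻¹ _ _ hu') (hV i hi).1 (hV i hi).2 ?_)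
    rw [gromovProduct_smul]
    linarith
  green := by
    intro g hg g1
    obtain ⟨f, w, n, h, ⟨l, hl, hgl⟩, hw0, hwn, h0, hn⟩ :=
      hW.exists_path hR (by linarith) hg hW.base hW.base
    rcases n with _ | n
    · rw [h.start, one_mul] at hgl
      exact hW.green g (hgl ▸ hl) g1
    · obtain ⟨-, hc, hd⟩ := hW.gallery_chain hR hX hL hδ hσ h h0 hn
      -- Any sail on the path would do; the first one is chosen.
      obtain ⟨H, k, hH, -⟩ := h.rot 0 (by omega)
      refine ⟨w 1, ⟨H, hH⟩, ?_⟩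
      have := hX.chain hc hd hδ 0 (by omega)
      rwa [hw0, hwn] at this

omit [IsIsometricSMul G X] in
theorem isWindmill_singleton (hδ : 0 < δ) (hx : ∀ v ∈ apices R, 20 * δ < dist v x) :
    IsWindmill δ R x {x} ⊥ where
  base := rfl
  inv := by simp
  qc := by
    rintro p rfl q rfl t
    exact ⟨_, rfl, by rw [gromovProduct_self, dist_comm]; linarith⟩
  near := by
    rintro H u hu w rfl h
    exact absurd h (not_le.2 (hx u ⟨H, hu⟩))
  green := by
    intro g hg h
    exact absurd (Subgroup.mem_bot.1 hg) h

/-- A growth step gains `δ / 2` in radius, because a point within `δ` of `m ∈ W` lies in the hull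
through the degenerate pair `(m, m)`. -/
theorem exists_isWindmill (hR : IsRotationFamily σ R)
    (hX : IsGromovHyperbolic X δ) (hL : IsLengthSpace X) (hδ : 0 < δ) (hσ : 200 * δ ≤ σ)
    (hx : ∀ v ∈ apices R, 20 * δ < dist v x) (n : ℕ) :
    ∃ W L, IsWindmill δ R x W L ∧ ∀ z, dist x z ≤ n * (δ / 2) → z ∈ W := by
  induction n with
  | zero =>
    refine ⟨{x}, ⊥, isWindmill_singleton hδ hx, fun z hz => ?_⟩
    have : dist x z = 0 := le_antisymm (by simpa using hz) dist_nonneg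
    exact (dist_eq_zero.1 this).symm
  | succ n ih =>
    obtain ⟨W, L, hW, hn⟩ := ih
    refine ⟨_, _, hW.grow hR hX hL hδ hσ, fun z hz => ?_⟩
    obtain ⟨m, hm, hm'⟩ := hL.exists_between x z (l := min (n * (δ / 2)) (dist x z)) (ε := δ / 2)
      (le_min (by positivity) dist_nonneg) (min_le_right _ _) (by positivity)
    have hmW : m ∈ W := hn m (by rw [hm]; exact min_le_left _ _)
    have hmz : dist m z ≤ δ := by
      push_cast at hz
      rcases min_choice ((n : ℝ) * (δ / 2)) (dist x z) with h | h <;> rw [h] at hm' <;> linarith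
    exact ⟨m, ⟨1, one_mem _, m, hmW, by simp⟩, m, ⟨1, one_mem _, m, hmW, by simp⟩, by
      rwa [gromovProduct_self]⟩

/-- Greendlinger's lemma. -/
theorem exists_apex_of_mem_rotationSubgroup (hR : IsRotationFamily σ R)
    (hX : IsGromovHyperbolic X δ) (hL : IsLengthSpace X) (hδ : 0 < δ) (hσ : 200 * δ ≤ σ)
    (hx : ∀ v ∈ apices R, 20 * δ < dist v x) {g : G} (hg : g ∈ rotationSubgroup R) (g1 : g ≠ 1) :
    ∃ v ∈ apices R, gromovProduct x (g • x) v ≤ 5 * δ := by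
  -- Quantifying over all windmills containing a large ball makes `M` a subgroup without comparing
  -- successive windmills: for a product, take the larger radius.
  let M : Subgroup G :=
    { carrier := {g | ∃ n : ℕ, ∀ W L, IsWindmill δ R x W L →
        (∀ z, dist x z ≤ n * (δ / 2) → z ∈ W) → g ∈ L}
      one_mem' := ⟨0, fun W L _ _ => one_mem L⟩
      inv_mem' := fun ⟨n, h⟩ => ⟨n, fun W L h1 h2 => inv_mem (h W L h1 h2)⟩
      mul_mem' := by
        rintro a b ⟨n, hn⟩ ⟨m, hm⟩
        refine ⟨max n m, fun W L h1 h2 => mul_mem (hn W L h1 fun z hz => h2 z (hz.trans ?_))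
          (hm W L h1 fun z hz => h2 z (hz.trans ?_))⟩ <;> gcongr <;> simp }
  have hM : rotationSubgroup R ≤ M := by
    refine sSup_le ?_
    rintro H ⟨v, hv⟩ h hh
    obtain ⟨n, hn⟩ := exists_nat_ge (dist x v / (δ / 2))
    rw [div_le_iff₀ (by positivity)] at hn
    exact ⟨n, fun W L h1 h2 => h1.near H v hv v (h2 v hn) (by rw [dist_self]; positivity) hh⟩
  obtain ⟨n, hn⟩ := hM hg
  obtain ⟨W, L, hW, hball⟩ := exists_isWindmill hR hX hL hδ hσ hx n
  exact hW.green g (hn W L hW hball) g1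

end Windmills

/-! ### Lifting from the quotient and the main theorem -/

section Quotient

variable {G X : Type*} [Group G] [MetricSpace X] [MulAction G X]

omit [MetricSpace X] in
theorem OrbitSpace.mk_smul (K : Subgroup G) {g : G} (hg : g ∈ K) (x : X) :
    OrbitSpace.mk K (g • x) = OrbitSpace.mk K x :=
  Quotient.sound ⟨⟨g, hg⟩, rfl⟩

variable [IsIsometricSMul G X]

theorem OrbitSpace.dist_mk_le (K : Subgroup G) (x y : X) :
    dist (OrbitSpace.mk K x) (OrbitSpace.mk K y) ≤ dist x y := by
  have := orbitDist_le K x y 1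
  rwa [OneMemClass.coe_one, one_smul] at this

theorem OrbitSpace.exists_dist_smul_le (K : Subgroup G) (x y : X) {ε : ℝ} (hε : 0 < ε) :
    ∃ g ∈ K, dist x (g • y) ≤ dist (OrbitSpace.mk K x) (OrbitSpace.mk K y) + ε := by
  obtain ⟨g, hg⟩ := exists_lt_of_ciInf_lt
    (show ⨅ g : K, dist ((g : G) • y) x < dist (OrbitSpace.mk K x) (OrbitSpace.mk K y) + ε by
      rw [← OrbitSpace.dist_mk, dist_comm]; linarith)
  exact ⟨g, g.2, by rw [dist_comm]; exact hg.le⟩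

variable {σ δ α : ℝ} {R : Set (Subgroup G × X)} {K : Subgroup G} {Ybar : Set (OrbitSpace K X)}

theorem lt_dist_of_disjoint {r : ℝ} (hY : ∀ v ∈ apices R, Disjoint Ybar
      (Metric.closedBall (OrbitSpace.mk K v) r)) {v : X} (hv : v ∈ apices R)
    {y : OrbitSpace K X} (hy : y ∈ Ybar) : r < dist (OrbitSpace.mk K v) y := by
  have := Set.disjoint_left.1 (hY v hv) hy
  rw [Metric.mem_closedBall, dist_comm] at this
  exact not_le.1 this

/-- An almost geodesic lift of a geodesic with endpoints in `Ybar` avoids the apices. -/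
theorem le_gromovProduct_of_lift (hqc : IsQuasiConvex α Ybar)
    (hY : ∀ v ∈ apices R, Disjoint Ybar
      (Metric.closedBall (OrbitSpace.mk K v) (σ / 10 + α + 8 * δ))) {y y' : X}
    (hy : OrbitSpace.mk K y ∈ Ybar) (hy' : OrbitSpace.mk K y' ∈ Ybar)
    (hd : dist y y' ≤ dist (OrbitSpace.mk K y) (OrbitSpace.mk K y') + δ) {v : X}
    (hv : v ∈ apices R) : σ / 10 + 15 / 2 * δ ≤ gromovProduct y y' v := by
  have h1 : σ / 10 + α + 8 * δ ≤ Metric.infDist (OrbitSpace.mk K v) Ybar :=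
    (Metric.le_infDist ⟨_, hy⟩).2 fun _ h => (lt_dist_of_disjoint hY hv h).le
  -- The `α` of quasi-convexity cancels that of the radius. Lifting costs `δ / 2`, as only the
  -- distance from `y` to `y'` may exceed its image, by at most `δ`.
  have h2 := hqc (OrbitSpace.mk K v) _ hy _ hy'
  have h3 := OrbitSpace.dist_mk_le K y v
  have h4 := OrbitSpace.dist_mk_le K y' v
  unfold gromovProduct at *
  linarith

end Quotient

theorem dist_mk_eq_of_lift {G X : Type*} [Group G] [MetricSpace X] [MulAction G X]
    [IsIsometricSMul G X] {σ δ α : ℝ} {R : Set (Subgroup G × X)}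
    {Ybar : Set (OrbitSpace (rotationSubgroup R) X)} (hR : IsRotationFamily σ R)
    (hX : IsGromovHyperbolic X δ) (hL : IsLengthSpace X) (hδ : 0 < δ) (hσ : 1000 * δ ≤ σ)
    (hα : 0 ≤ α) (hqc : IsQuasiConvex α Ybar)
    (hY : ∀ v ∈ apices R, Disjoint Ybar
      (Metric.closedBall (OrbitSpace.mk (rotationSubgroup R) v) (σ / 10 + α + 8 * δ)))
    {y₀ y y' : X} (hy₀ : OrbitSpace.mk (rotationSubgroup R) y₀ ∈ Ybar)
    (hy : OrbitSpace.mk (rotationSubgroup R) y ∈ Ybar)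
    (hy' : OrbitSpace.mk (rotationSubgroup R) y' ∈ Ybar)
    (hd : dist y₀ y ≤ dist (OrbitSpace.mk (rotationSubgroup R) y₀)
      (OrbitSpace.mk (rotationSubgroup R) y) + δ)
    (hd' : dist y₀ y' ≤ dist (OrbitSpace.mk (rotationSubgroup R) y₀)
      (OrbitSpace.mk (rotationSubgroup R) y') + δ) :
    dist (OrbitSpace.mk (rotationSubgroup R) y) (OrbitSpace.mk (rotationSubgroup R) y')
      = dist y y' := by
  refine le_antisymm (OrbitSpace.dist_mk_le _ y y') (le_of_forall_pos_le_add fun ε hε => ?_)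
  obtain ⟨g, hg, hgd⟩ := OrbitSpace.exists_dist_smul_le (rotationSubgroup R) y y'
    (lt_min hε hδ)
  have hmk := OrbitSpace.mk_smul (rotationSubgroup R) hg y'
  suffices g1 : g = 1 by
    rw [g1, one_smul] at hgd
    linarith [min_le_left ε δ]
  by_contra g1
  obtain ⟨v, hv, h1⟩ := exists_apex_of_mem_rotationSubgroup hR hX hL hδ (by linarith)
    (x := y') (fun v hv => by
      have h2 := lt_dist_of_disjoint hY hv hy'
      have h3 := OrbitSpace.dist_mk_le (rotationSubgroup R) v y'
      linarith) hg g1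
  have h2 := le_gromovProduct_of_lift hqc hY hy₀ hy' hd' hv
  have h3 := le_gromovProduct_of_lift hqc hY hy₀ hy hd hv
  have h4 := le_gromovProduct_of_lift hqc hY hy (y' := g • y') (by rwa [hmk])
    (by rw [hmk]; linarith [min_le_right ε δ]) hv
  rw [gromovProduct_comm] at h2
  -- This gives `(y' | g y')_v ≥ σ / 10 + 11 / 2 * δ`, against `h1`.
  have h5 := hX.four y' y₀ y (g • y') v
  have h6 := le_min h2 (le_min h3 h4)
  linarith

theorem mainTheorem6 (δ : ℝ) (hδ : 0 < δ) :
    ∃ σ₀ : ℝ, 0 < σ₀ ∧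
      ∀ (X : Type u) (G : Type v) [MetricSpace X] [Group G] [MulAction G X]
        [IsIsometricSMul G X],
        IsLengthSpace X → IsGromovHyperbolic X δ →
      ∀ (σ : ℝ), σ₀ ≤ σ → ∀ (R : Set (Subgroup G × X)), IsRotationFamily σ R →
      ∀ (α : ℝ), 0 ≤ α → ∀ (Ybar : Set (OrbitSpace (rotationSubgroup R) X)),
        IsQuasiConvex α Ybar →
        (∀ v ∈ apices R, Disjoint Ybar
          (Metric.closedBall (OrbitSpace.mk (rotationSubgroup R) v) (σ / 10 + α + 8 * δ))) →
      ∀ ybar₀ ∈ Ybar, ∀ y₀ : X, OrbitSpace.mk (rotationSubgroup R) y₀ = ybar₀ →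
      ∃ Y : Set X, y₀ ∈ Y ∧
        OrbitSpace.mk (rotationSubgroup R) '' Y = Ybar ∧
        ∀ y ∈ Y, ∀ y' ∈ Y,
          dist (OrbitSpace.mk (rotationSubgroup R) y) (OrbitSpace.mk (rotationSubgroup R) y')
            = dist y y' := by
  -- A generous constant: the estimates only need `200 * δ ≤ σ`.
  refine ⟨1000 * δ, by positivity, ?_⟩
  intro X G _ _ _ _ hL hX σ hσ R hR α hα Ybar hqc hY ybar₀ hy₀ y₀ hmk
  subst hmk
  -- The slack `δ` guarantees that every point of `Ybar` has a lift in the set, since the infimum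
  -- over `K` need not be attained.
  refine ⟨{y | OrbitSpace.mk (rotationSubgroup R) y ∈ Ybar ∧
    dist y₀ y ≤ dist (OrbitSpace.mk (rotationSubgroup R) y₀)
      (OrbitSpace.mk (rotationSubgroup R) y) + δ},
    ⟨hy₀, by rw [dist_self, dist_self]; linarith⟩, ?_, ?_⟩
  · refine Set.Subset.antisymm (Set.image_subset_iff.2 fun y hy => hy.1) fun z hz => ?_
    induction z using Quotient.inductionOn with
    | h z =>
      obtain ⟨g, hg, hgd⟩ := OrbitSpace.exists_dist_smul_le (rotationSubgroup R) y₀ z hδ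
      have hmk := OrbitSpace.mk_smul (rotationSubgroup R) hg z
      exact ⟨g • z, ⟨by rw [hmk]; exact hz, by rw [hmk]; exact hgd⟩, hmk⟩
  · intro y hy y' hy'
    exact dist_mk_eq_of_lift hR hX hL hδ hσ hα hqc hY hy₀ hy.1 hy'.1 hy.2 hy'.2
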